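/- All graphs are finite, undirected and simple. The strong product $G \boxtimes H$ has vertex set $V(G)\times V(H)$, two distinct vertices being adjacent if and only if in each coordinate they are equal or adjacent; $G^{\boxtimes k} = G \boxtimes \cdots \boxtimes G$ ($k$ factors). The eigenvalues of a graph on $N$ vertices are those of its adjacency matrix, listed with multiplicity as $\lambda_1 \ge \lambda_2 \ge \cdots \ge \lambda_N = \lambda_{\min}$. The Lovász function is $$\theta(G) = \min_{u, c}\ \max_{i \in V(G)} \frac{1}{(c^{\mathrm T} u_i)^2},$$ where the minimum is over all families $(u_i)_{i \in V(G)}$ of unit vectors in a Euclidean space such that $u_i^{\mathrm T} u_j = 0$ for all distinct non-adjacent $i, j$, and over all unit vectors $c$ of that space (with $1/0 = +\infty$). Let $G$ be a $d$-regular graph on $n$ vertices and let $k \ge 1$ be an integer. (a) If $G$ is not a complete graph, then $\theta(G)^k > 1$ and $$\lambda_2(G^{\boxtimes k}) \ \ge\ \frac{n^k - (1+d)^k}{\theta(G)^k - 1} - 1 .$$ (b) If $G$ has at least one edge, then $\bigl(\tfrac{n}{\theta(G)}\bigr)^k > 1$ and $$\lambda_{\min}(G^{\boxtimes k}) \ \le\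 -\,\frac{(1+d)^k - 1}{\bigl(\tfrac{n}{\theta(G)}\bigr)^k - 1} .$$ -/

import Mathlib

noncomputable section

namespace SimpleGraph

universe u v

/-- The strong product `G ⊠ H`: distinct vertices are adjacent when in each coordinate they are
equal or adjacent. -/
def strongProd {V : Type u} {W : Type v} (G : SimpleGraph V) (H : SimpleGraph W) :
    SimpleGraph (V × W) where
  Adj x y :=
    (x.1 = y.1 ∧ H.Adj x.2 y.2) ∨ (G.Adj x.1 y.1 ∧ x.2 = y.2) ∨
      (G.Adj x.1 y.1 ∧ H.Adj x.2 y.2)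
  symm := ⟨by
    rintro x y (⟨h, h'⟩ | ⟨h, h'⟩ | ⟨h, h'⟩)
    · exact Or.inl ⟨h.symm, h'.symm⟩
    · exact Or.inr (Or.inl ⟨h.symm, h'.symm⟩)
    · exact Or.inr (Or.inr ⟨h.symm, h'.symm⟩)⟩
  loopless := ⟨by
    rintro x (⟨_, h⟩ | ⟨h, _⟩ | ⟨h, _⟩)
    · exact H.loopless.irrefl _ h
    · exact G.loopless.irrefl _ h
    · exact G.loopless.irrefl _ h⟩

/-- The `k`-fold strong power of `G`, with vertices the `k`-tuples of vertices of `G`: distinct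
tuples are adjacent when in each coordinate they are equal or adjacent. The two isomorphisms
`strongPowerOneIso` and `strongPowerSuccIso` below show that it is the iterated strong product
`G ⊠ ⋯ ⊠ G` of `k` factors. -/
def strongPower {V : Type u} (G : SimpleGraph V) (k : ℕ) : SimpleGraph (Fin k → V) where
  Adj x y := x ≠ y ∧ ∀ i, x i = y i ∨ G.Adj (x i) (y i)
  symm := ⟨fun _ _ h => ⟨h.1.symm, fun i => (h.2 i).imp Eq.symm fun h' => h'.symm⟩⟩
  loopless := ⟨fun _ h => h.1 rfl⟩

/-- The first strong power of `G` is `G`. -/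
def strongPowerOneIso {V : Type u} (G : SimpleGraph V) : G.strongPower 1 ≃g G where
  toEquiv := Equiv.funUnique (Fin 1) V
  map_rel_iff' := by
    intro x y
    have h : x = y ↔ x 0 = y 0 := by simp [funext_iff]
    have h' := fun e : G.Adj (x 0) (y 0) => e.ne
    simp only [strongPower, Equiv.funUnique_apply, Fin.forall_fin_one, ne_eq, h]
    change G.Adj (x 0) (y 0) ↔ _
    tauto

/-- The `(k+1)`-st strong power of `G` is the strong product of `G` and its `k`-th strong power. -/
def strongPowerSuccIso {V : Type u} (G : SimpleGraph V) (k : ℕ) :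
    G.strongPower (k + 1) ≃g G.strongProd (G.strongPower k) where
  toEquiv := (Fin.consEquiv fun _ : Fin (k + 1) => V).symm
  map_rel_iff' := by
    intro x y
    have h : x = y ↔ x 0 = y 0 ∧ Fin.tail x = Fin.tail y := by
      simp [funext_iff, Fin.forall_fin_succ, Fin.tail]
    have h' := fun e : G.Adj (x 0) (y 0) => e.ne
    have h'' : Fin.tail x = Fin.tail y →
        ∀ i : Fin k, x i.succ = y i.succ ∨ G.Adj (x i.succ) (y i.succ) :=
      fun e i => Or.inl (congrFun e i)
    simp only [strongPower, strongProd, Fin.consEquiv, Equiv.coe_fn_symm_mk, ne_eq, h,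
      Fin.forall_fin_succ, Fin.tail_def] at *
    tauto

/-- `u` is an orthonormal representation of `G` in the Euclidean space `ℝᵐ`: a unit vector for each
vertex, with orthogonal vectors for distinct non-adjacent vertices. -/
def IsOrthonormalRep {V : Type u} (G : SimpleGraph V) {m : ℕ}
    (u : V → EuclideanSpace ℝ (Fin m)) : Prop :=
  (∀ i, ‖u i‖ = 1) ∧ ∀ i j, i ≠ j → ¬ G.Adj i j → inner ℝ (u i) (u j) = 0

/-- The Lovász theta function: the least value of `max_i 1 / (cᵀ u_i)²` over all orthonormal
representations `u` (in any dimension) and all unit vectors `c`. A pair with `cᵀ u_i = 0` for some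
`i` has the value `+∞`, so it is left out. -/
def lovaszTheta {V : Type u} (G : SimpleGraph V) : ℝ :=
  sInf {t : ℝ | ∃ (m : ℕ) (u : V → EuclideanSpace ℝ (Fin m)) (c : EuclideanSpace ℝ (Fin m)),
    G.IsOrthonormalRep u ∧ ‖c‖ = 1 ∧ (∀ i, inner ℝ c (u i) ≠ 0) ∧
      t = ⨆ i, 1 / (inner ℝ c (u i)) ^ 2}

open Classical in
/-- The adjacency matrix of `G` over the reals is symmetric. -/
theorem adjMatrix_real_isHermitian {V : Type u} (G : SimpleGraph V) :
    (G.adjMatrix ℝ).IsHermitian := by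
  rw [Matrix.IsHermitian, Matrix.conjTranspose_eq_transpose_of_trivial]
  exact G.isSymm_adjMatrix

open Classical in
/-- The `l`-th largest eigenvalue of the adjacency matrix of `G`, counted with multiplicity, for
`1 ≤ l ≤ |V|` (and `0` for other `l`). Mathlib's `eigenvalues₀` lists the eigenvalues in decreasing
order, starting at index `0`. -/
def eigval {V : Type u} [Fintype V] (G : SimpleGraph V) (l : ℕ) : ℝ :=
  if h : 1 ≤ l ∧ l ≤ Fintype.card V then
    G.adjMatrix_real_isHermitian.eigenvalues₀ ⟨l - 1, by omega⟩
  else 0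

/-- The smallest eigenvalue of the adjacency matrix of `G`. -/
def minEigval {V : Type u} [Fintype V] (G : SimpleGraph V) : ℝ :=
  G.eigval (Fintype.card V)

end SimpleGraph

end

/-! Let C = A + I, with A the adjacency matrix. For a strong power, C is the tensor power of the C
of G (`closedAdjMatrix_strongPower`), so eigenvectors of C can be tensored.

For (a), take a D-regular graph on N vertices. Regularity makes J - C + (1 + λ₂) I positive
semidefinite (`eigval_two_bounds`). Scale a representation so that cᵀw_i = 1 for all i, with squared
norms at most T. The vectors w_i - c have Gram matrix W - J, where W vanishes at distinct
non-adjacent pairs. Pairing the two semidefinite matrices gives N - (1 + D) ≤ (1 + λ₂)(T - 1)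
(`IsScaledRep.card_sub_le`). Apply this to the strong power, with tensor powers of representations
of G (`IsScaledRep.strongPower`), and pass to the infimum.

For (b), put μ = -λ_min(G). Hoffman's bound `lovaszTheta_mul_le` gives n/θ ≥ 1 + d/μ. Tensoring a
λ_min-eigenvector with all-ones vectors bounds λ_min of the k-th power by -((1 + d)^(k-1) (μ - 1) +
1). The elementary inequality `pow_sub_one_le_of_hoffman` links the two. -/

noncomputable section

open scoped Matrix

/-! ### Rayleigh quotients of real symmetric matrices -/

namespace Matrix.IsHermitian

variable {ι : Type*} [Fintype ι] [DecidableEq ι] {A : Matrix ι ι ℝ}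

/-- The coordinates of `x` in the eigenvector basis of a symmetric matrix. -/
def coord (hA : A.IsHermitian) (x : ι → ℝ) (i : ι) : ℝ :=
  (hA.eigenvectorBasis i : ι → ℝ) ⬝ᵥ x

theorem coord_mulVec (hA : A.IsHermitian) (x : ι → ℝ) (i : ι) :
    hA.coord (A *ᵥ x) i = hA.eigenvalues i * hA.coord x i := by
  have h : Aᵀ = A := by simpa [Matrix.IsHermitian] using hA
  have h' := hA.mulVec_eigenvectorBasis i
  rw [coord, Matrix.dotProduct_mulVec, ← Matrix.mulVec_transpose, h, h', smul_dotProduct, coord,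
    smul_eq_mul]

theorem sum_coord_mul_coord (hA : A.IsHermitian) (x y : ι → ℝ) :
    ∑ i, hA.coord x i * hA.coord y i = x ⬝ᵥ y := by
  have h := hA.eigenvectorBasis.sum_inner_mul_inner (WithLp.toLp 2 x) (WithLp.toLp 2 y)
  simp only [EuclideanSpace.inner_eq_star_dotProduct, star_trivial] at h
  rw [dotProduct_comm x y, ← h]
  exact Finset.sum_congr rfl fun i _ => by rw [coord, coord, dotProduct_comm _ y]

theorem dotProduct_mulVec_eq_sum (hA : A.IsHermitian) (x : ι → ℝ) :
    x ⬝ᵥ A *ᵥ x = ∑ i, hA.eigenvalues i * hA.coord x i ^ 2 := by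
  rw [← hA.sum_coord_mul_coord]
  exact Finset.sum_congr rfl fun i _ => by rw [coord_mulVec]; ring

theorem dotProduct_self_eq_sum (hA : A.IsHermitian) (x : ι → ℝ) :
    x ⬝ᵥ x = ∑ i, hA.coord x i ^ 2 := by
  rw [← hA.sum_coord_mul_coord]
  exact Finset.sum_congr rfl fun i _ => by ring

theorem eigenvalues_equivOfCardEq (hA : A.IsHermitian) (l : Fin (Fintype.card ι)) :
    hA.eigenvalues (Fintype.equivOfCardEq (Fintype.card_fin _) l) = hA.eigenvalues₀ l := by
  simp [eigenvalues]

/-- The last eigenvalue is a lower bound for the Rayleigh quotient. -/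
theorem last_eigenvalue_mul_le (hA : A.IsHermitian) (l : Fin (Fintype.card ι))
    (hl : ∀ j, j ≤ l) (x : ι → ℝ) :
    hA.eigenvalues₀ l * (x ⬝ᵥ x) ≤ x ⬝ᵥ A *ᵥ x := by
  rw [hA.dotProduct_self_eq_sum, hA.dotProduct_mulVec_eq_sum, Finset.mul_sum]
  exact Finset.sum_le_sum fun i _ =>
    mul_le_mul_of_nonneg_right (hA.eigenvalues₀_antitone (hl _)) (sq_nonneg _)

theorem exists_eigenvector (hA : A.IsHermitian) (l : Fin (Fintype.card ι)) :
    ∃ x : ι → ℝ, x ≠ 0 ∧ A *ᵥ x = hA.eigenvalues₀ l • x := by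
  refine ⟨hA.eigenvectorBasis (Fintype.equivOfCardEq (Fintype.card_fin _) l), fun h => ?_, ?_⟩
  · apply hA.eigenvectorBasis.orthonormal.ne_zero
      (Fintype.equivOfCardEq (Fintype.card_fin _) l)
    ext i
    exact congrFun h i
  · rw [hA.mulVec_eigenvectorBasis, eigenvalues_equivOfCardEq]

/-- The Rayleigh quotient is at most the second largest eigenvalue on vectors orthogonal to the
first eigenvector of the basis. -/
theorem dotProduct_mulVec_le_of_coord_eq_zero (hA : A.IsHermitian)
    (h1 : 1 < Fintype.card ι) (x : ι → ℝ)
    (hx : hA.coord x (Fintype.equivOfCardEq (Fintype.card_fin _) ⟨0, by omega⟩) = 0) :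
    x ⬝ᵥ A *ᵥ x ≤ hA.eigenvalues₀ ⟨1, h1⟩ * (x ⬝ᵥ x) := by
  rw [hA.dotProduct_self_eq_sum, hA.dotProduct_mulVec_eq_sum, Finset.mul_sum]
  refine Finset.sum_le_sum fun i _ => ?_
  obtain ⟨l, rfl⟩ := (Fintype.equivOfCardEq (Fintype.card_fin (Fintype.card ι))).surjective i
  by_cases hl : l = ⟨0, by omega⟩
  · subst hl
    simp [hx]
  · rw [eigenvalues_equivOfCardEq]
    refine mul_le_mul_of_nonneg_right (hA.eigenvalues₀_antitone ?_) (sq_nonneg _)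
    rw [Fin.le_def]
    have : (l : ℕ) ≠ 0 := fun h => hl (Fin.ext h)
    show 1 ≤ (l : ℕ)
    omega

/-- If `e` is an eigenvector for an upper bound `D` of the Rayleigh quotient, then the
second largest eigenvalue bounds the Rayleigh quotient on the orthogonal complement of `e`. -/
theorem dotProduct_mulVec_le_of_orthogonal (hA : A.IsHermitian) (h1 : 1 < Fintype.card ι)
    {D : ℝ} {e : ι → ℝ} (he0 : e ≠ 0) (he : A *ᵥ e = D • e) (hD : ∀ x : ι → ℝ, x ⬝ᵥ A *ᵥ x ≤ D * (x ⬝ᵥ x))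
    (x : ι → ℝ) (hx : e ⬝ᵥ x = 0) :
    x ⬝ᵥ A *ᵥ x ≤ hA.eigenvalues₀ ⟨1, h1⟩ * (x ⬝ᵥ x) := by
  set i0 : ι := Fintype.equivOfCardEq (Fintype.card_fin (Fintype.card ι)) ⟨0, by omega⟩ with hi0
  set l2 := hA.eigenvalues₀ ⟨1, h1⟩
  by_cases hx0 : hA.coord x i0 = 0
  · exact hA.dotProduct_mulVec_le_of_coord_eq_zero h1 x hx0
  set p := hA.coord x i0
  set q := hA.coord e i0
  -- If D is a multiple eigenvalue, `e` need not be parallel to the first basis vector. This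
  -- combination is orthogonal to that vector, and its quadratic form has no cross terms because e ⟂
  -- x and e ⟂ Ax.
  have hz0 : hA.coord (p • e - q • x) i0 = 0 := by
    simp only [coord, dotProduct_sub, dotProduct_smul, smul_eq_mul]
    simp only [p, q, coord]
    ring
  have hz := hA.dotProduct_mulVec_le_of_coord_eq_zero h1 _ hz0
  have hxe : x ⬝ᵥ e = 0 := by rw [dotProduct_comm, hx]
  have hAT : Aᵀ = A := by simpa [Matrix.IsHermitian] using hA
  have heA : e ⬝ᵥ A *ᵥ x = 0 := by
    rw [Matrix.dotProduct_mulVec, ← Matrix.mulVec_transpose, hAT, he, smul_dotProduct, hx,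
      smul_zero]
  simp only [Matrix.mulVec_sub, Matrix.mulVec_smul, dotProduct_sub, sub_dotProduct,
    dotProduct_smul, smul_dotProduct, he, hx, hxe, heA, smul_eq_mul] at hz
  have hDx := hD x
  have hx_nonneg : 0 ≤ x ⬝ᵥ x := by simpa using dotProduct_star_self_nonneg x
  have he_nonneg : 0 ≤ e ⬝ᵥ e := by simpa using dotProduct_star_self_nonneg e
  by_contra! hlt
  have hx_pos : 0 < x ⬝ᵥ x := by
    refine lt_of_le_of_ne hx_nonneg fun h => hx0 ?_
    have : x = 0 := dotProduct_self_eq_zero.mp h.symm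
    simp [p, this, coord]
  have hlD : l2 < D := lt_of_mul_lt_mul_right (hlt.trans_le hDx) hx_nonneg
  by_cases hq : q = 0
  · have hp : 0 < p ^ 2 := by positivity
    have hee : e ⬝ᵥ e = 0 := by
      rw [hq] at hz
      have h2 : 0 ≤ (D - l2) * (p ^ 2 * (e ⬝ᵥ e)) :=
        mul_nonneg (sub_nonneg.2 hlD.le) (by positivity)
      have h3 : (D - l2) * (p ^ 2 * (e ⬝ᵥ e)) = 0 := le_antisymm (by linarith) h2
      have := sub_ne_zero.2 hlD.ne'
      simpa [this, hp.ne', hx0] using h3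
    exact he0 (dotProduct_self_eq_zero.mp hee)
  · have hq2 : 0 < q ^ 2 := by positivity
    have h2 : 0 ≤ (D - l2) * (p ^ 2 * (e ⬝ᵥ e)) :=
      mul_nonneg (sub_nonneg.2 hlD.le) (by positivity)
    have h3 := mul_pos hq2 (sub_pos.2 hlt)
    linarith

end Matrix.IsHermitian

/-! ### Matrices with constant row sums -/

namespace SimpleGraph

/-- Splitting a vector into a constant part and a part of zero sum, for a symmetric matrix with
constant row sums. -/
theorem exists_constant_add_of_mulVec_one {V : Type*} [Fintype V] [Nonempty V] {A : Matrix V V ℝ}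
    (hA : A.IsHermitian) {D : ℝ} (hD : A *ᵥ 1 = D • 1) (x : V → ℝ) :
    ∃ (a : ℝ) (y : V → ℝ), (1 : V → ℝ) ⬝ᵥ y = 0 ∧ ∑ i, x i = a * Fintype.card V ∧
      x ⬝ᵥ x = a ^ 2 * Fintype.card V + y ⬝ᵥ y ∧
      x ⬝ᵥ A *ᵥ x = a ^ 2 * Fintype.card V * D + y ⬝ᵥ A *ᵥ y := by
  have hAT : Aᵀ = A := by simpa [Matrix.IsHermitian] using hA
  have hN : (Fintype.card V : ℝ) ≠ 0 := by simp
  have h11 : (1 : V → ℝ) ⬝ᵥ 1 = Fintype.card V := by simp [dotProduct]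
  obtain ⟨a, hsum⟩ : ∃ a, ∑ i, x i = a * Fintype.card V :=
    ⟨(∑ i, x i) / Fintype.card V, by field_simp⟩
  have hy : (1 : V → ℝ) ⬝ᵥ (x - a • 1) = 0 := by
    rw [dotProduct_sub, dotProduct_smul, h11, one_dotProduct, hsum]
    simp
  obtain ⟨y, rfl⟩ : ∃ y, x = a • 1 + y := ⟨x - a • 1, by simp⟩
  simp only [add_sub_cancel_left] at hy
  have hy' : y ⬝ᵥ (1 : V → ℝ) = 0 := by rw [dotProduct_comm, hy]
  have h1A : (1 : V → ℝ) ⬝ᵥ A *ᵥ y = 0 := by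
    rw [Matrix.dotProduct_mulVec, ← Matrix.mulVec_transpose, hAT, hD, smul_dotProduct, hy,
      smul_zero]
  refine ⟨a, y, hy, hsum, ?_, ?_⟩
  · simp only [dotProduct_add, add_dotProduct, dotProduct_smul, smul_dotProduct, h11, hy, hy',
      smul_eq_mul]
    ring
  · simp only [Matrix.mulVec_add, Matrix.mulVec_smul, dotProduct_add, add_dotProduct,
      dotProduct_smul, smul_dotProduct, h11, hy', hD, h1A, smul_eq_mul]
    ring

/-- The Laplacian form ∑ A i j (x i - x j)² is nonnegative and expands to twice the difference of
the two sides. -/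
theorem dotProduct_mulVec_le_of_mulVec_one {V : Type*} [Fintype V] {A : Matrix V V ℝ}
    (hA : A.IsHermitian) (hA0 : ∀ i j, 0 ≤ A i j) {D : ℝ} (hD : A *ᵥ 1 = D • 1) (x : V → ℝ) :
    x ⬝ᵥ A *ᵥ x ≤ D * (x ⬝ᵥ x) := by
  have hrow : ∀ i, ∑ j, A i j = D := fun i => by
    simpa [Matrix.mulVec, dotProduct] using congrFun hD i
  have hsymm : ∀ i j, A i j = A j i := fun i j => by simpa using hA.apply j i
  have h0 : 0 ≤ ∑ i, ∑ j, A i j * (x i - x j) ^ 2 :=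
    Finset.sum_nonneg fun i _ => Finset.sum_nonneg fun j _ => mul_nonneg (hA0 i j) (sq_nonneg _)
  have h1 : ∑ i, ∑ j, A i j * x i ^ 2 = D * (x ⬝ᵥ x) := by
    rw [dotProduct, Finset.mul_sum]
    refine Finset.sum_congr rfl fun i _ => ?_
    rw [← Finset.sum_mul, hrow]
    ring
  have h2 : ∑ i, ∑ j, A i j * x j ^ 2 = D * (x ⬝ᵥ x) := by
    rw [Finset.sum_comm, ← h1]
    exact Finset.sum_congr rfl fun i _ => Finset.sum_congr rfl fun j _ => by rw [hsymm]
  have h3 : ∑ i, ∑ j, A i j * (x i * x j) = x ⬝ᵥ A *ᵥ x := by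
    simp only [dotProduct, Matrix.mulVec, Finset.mul_sum]
    exact Finset.sum_congr rfl fun i _ => Finset.sum_congr rfl fun j _ => by ring
  have h4 : ∑ i, ∑ j, A i j * (x i - x j) ^ 2 = ∑ i, ∑ j, A i j * x i ^ 2
      + ∑ i, ∑ j, A i j * x j ^ 2 - 2 * ∑ i, ∑ j, A i j * (x i * x j) := by
    simp only [Finset.mul_sum, ← Finset.sum_add_distrib, ← Finset.sum_sub_distrib]
    exact Finset.sum_congr rfl fun i _ => Finset.sum_congr rfl fun j _ => by ring
  rw [h1, h2, h3] at h4
  linarith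

/-! ### The matrix A + I and strong powers -/

open Classical in
/-- The adjacency matrix plus the identity. -/
def closedAdjMatrix {V : Type*} (G : SimpleGraph V) : Matrix V V ℝ :=
  G.adjMatrix ℝ + 1

theorem closedAdjMatrix_apply {V : Type*} (G : SimpleGraph V) (i j : V)
    [Decidable (i = j ∨ G.Adj i j)] :
    G.closedAdjMatrix i j = if i = j ∨ G.Adj i j then 1 else 0 := by
  classical
  by_cases h : i = j
  · subst h; simp [closedAdjMatrix]
  · simp [closedAdjMatrix, h, adjMatrix_apply]

theorem closedAdjMatrix_strongPower {V : Type*} (G : SimpleGraph V) {k : ℕ} (x y : Fin k → V) :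
    (G.strongPower k).closedAdjMatrix x y = ∏ i, G.closedAdjMatrix (x i) (y i) := by
  classical
  simp only [closedAdjMatrix_apply]
  rw [Finset.prod_ite_zero]
  simp only [Finset.prod_const_one, Finset.mem_univ, true_implies]
  congr 1
  apply propext
  constructor
  · rintro (h | h) i
    · exact Or.inl (congrFun h i)
    · exact h.2 i
  · intro h
    by_cases hxy : x = y
    · exact Or.inl hxy
    · exact Or.inr ⟨hxy, h⟩

theorem closedAdjMatrix_strongPower_mulVec {V : Type*} [Fintype V] (G : SimpleGraph V) {k : ℕ}
    {f : Fin k → V → ℝ} {α : Fin k → ℝ} (h : ∀ i, G.closedAdjMatrix *ᵥ f i = α i • f i) :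
    (G.strongPower k).closedAdjMatrix *ᵥ (fun y => ∏ i, f i (y i)) =
      (∏ i, α i) • fun y => ∏ i, f i (y i) := by
  classical
  ext x
  simp only [Matrix.mulVec, dotProduct, closedAdjMatrix_strongPower, ← Finset.prod_mul_distrib,
    Pi.smul_apply, smul_eq_mul]
  rw [← Fintype.prod_sum fun i j => G.closedAdjMatrix (x i) j * f i j]
  exact Finset.prod_congr rfl fun i _ => congrFun (h i) (x i)

open Classical in
theorem adjMatrix_mulVec_eq_smul_iff {V : Type*} [Fintype V] (G : SimpleGraph V) (x : V → ℝ)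
    (c : ℝ) : G.adjMatrix ℝ *ᵥ x = c • x ↔ G.closedAdjMatrix *ᵥ x = (1 + c) • x := by
  rw [closedAdjMatrix, Matrix.add_mulVec, Matrix.one_mulVec, add_smul, one_smul, add_comm x,
    add_left_inj]

open Classical in
theorem adjMatrix_nonneg {V : Type*} (G : SimpleGraph V) (i j : V) : 0 ≤ G.adjMatrix ℝ i j := by
  rw [adjMatrix_apply]; split_ifs <;> simp

open Classical in
theorem card_sub_one_of_adjMatrix_mulVec_one {V : Type*} [Fintype V] [Nonempty V]
    (G : SimpleGraph V) {D : ℝ} (hD : G.adjMatrix ℝ *ᵥ 1 = D • 1) :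
    1 + D ≤ Fintype.card V := by
  obtain ⟨i⟩ := ‹Nonempty V›
  rw [adjMatrix_mulVec_eq_smul_iff] at hD
  have h : ∑ j, G.closedAdjMatrix i j = 1 + D := by
    simpa [Matrix.mulVec, dotProduct] using congrFun hD i
  rw [← h]
  calc ∑ j, G.closedAdjMatrix i j ≤ ∑ j : V, (1 : ℝ) :=
        Finset.sum_le_sum fun j _ => by rw [closedAdjMatrix_apply]; split_ifs <;> simp
    _ = _ := by simp

open Classical in
theorem dotProduct_single_sub_single {V : Type*} [Fintype V] (G : SimpleGraph V) {i j : V}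
    (h : i ≠ j) :
    (Pi.single i 1 - Pi.single j 1 : V → ℝ) ⬝ᵥ (Pi.single i 1 - Pi.single j 1) = 2 ∧
    (Pi.single i 1 - Pi.single j 1 : V → ℝ) ⬝ᵥ
      G.adjMatrix ℝ *ᵥ (Pi.single i 1 - Pi.single j 1) = -2 * G.adjMatrix ℝ i j := by
  have h' := G.adj_comm i j
  constructor
  · simp [h, h.symm]; norm_num
  · simp [sub_dotProduct, Matrix.mulVec_sub, adjMatrix_apply, h']
    split_ifs <;> norm_num

/-! ### Second and smallest eigenvalues of graphs -/

open Classical in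
/-- A regular graph on at least two vertices satisfies `A ≤ J + λ₂ I`, and `λ₂ ≥ -1`. -/
theorem eigval_two_bounds {V : Type*} [Fintype V] (G : SimpleGraph V) (h1 : 1 < Fintype.card V)
    {D : ℝ} (hD : G.adjMatrix ℝ *ᵥ 1 = D • 1) :
    -1 ≤ G.eigval 2 ∧ ∀ x : V → ℝ,
      x ⬝ᵥ G.adjMatrix ℝ *ᵥ x ≤ (∑ i, x i) ^ 2 + G.eigval 2 * (x ⬝ᵥ x) := by
  have : Nonempty V := Fintype.card_pos_iff.1 (by omega)
  have hA := G.adjMatrix_real_isHermitian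
  have hl : G.eigval 2 = hA.eigenvalues₀ ⟨1, h1⟩ := by
    rw [eigval, dif_pos ⟨by omega, h1⟩]
  have key := hA.dotProduct_mulVec_le_of_orthogonal h1 (one_ne_zero) hD
    (dotProduct_mulVec_le_of_mulVec_one hA G.adjMatrix_nonneg hD)
  rw [← hl] at key
  have hm1 : -1 ≤ G.eigval 2 := by
    obtain ⟨i, j, hij⟩ := Fintype.exists_pair_of_one_lt_card h1
    have h := key (Pi.single i 1 - Pi.single j 1) (by simp [dotProduct_sub])
    rw [(G.dotProduct_single_sub_single hij).1, (G.dotProduct_single_sub_single hij).2] at h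
    have : G.adjMatrix ℝ i j ≤ 1 := by rw [adjMatrix_apply]; split_ifs <;> simp
    linarith
  refine ⟨hm1, fun x => ?_⟩
  obtain ⟨a, y, hy, hs, hxx, hxA⟩ := exists_constant_add_of_mulVec_one hA hD x
  have h := key y hy
  have hc := G.card_sub_one_of_adjMatrix_mulVec_one hD
  -- The zero-sum part is settled by `key`; the constant part needs D ≤ N + λ₂, which follows from 1
  -- + D ≤ N and λ₂ ≥ -1.
  rw [hs, hxx, hxA]
  have : 0 ≤ a ^ 2 * Fintype.card V * (Fintype.card V + G.eigval 2 - D) :=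
    mul_nonneg (by positivity) (by linarith)
  linarith

theorem minEigval_mul_le {V : Type*} [Fintype V] [Nonempty V] (G : SimpleGraph V) :
    open Classical in
    (∀ x : V → ℝ, G.minEigval * (x ⬝ᵥ x) ≤ x ⬝ᵥ G.adjMatrix ℝ *ᵥ x) ∧
      ∃ x : V → ℝ, x ≠ 0 ∧ G.adjMatrix ℝ *ᵥ x = G.minEigval • x := by
  classical
  have hc : 1 ≤ Fintype.card V := Fintype.card_pos
  rw [minEigval, eigval, dif_pos ⟨hc, le_rfl⟩]
  refine ⟨G.adjMatrix_real_isHermitian.last_eigenvalue_mul_le _ fun j => ?_,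
    G.adjMatrix_real_isHermitian.exists_eigenvector _⟩
  rw [Fin.le_def]
  have := j.2
  show (j : ℕ) ≤ Fintype.card V - 1
  omega

theorem minEigval_le_neg_one {V : Type*} [Fintype V] (G : SimpleGraph V) (hG : G ≠ ⊥) :
    G.minEigval ≤ -1 := by
  classical
  obtain ⟨i, j, hij⟩ := SimpleGraph.ne_bot_iff_exists_adj.1 hG
  have : Nonempty V := ⟨i⟩
  have h := G.minEigval_mul_le.1 (Pi.single i 1 - Pi.single j 1)
  rw [(G.dotProduct_single_sub_single hij.ne).1, (G.dotProduct_single_sub_single hij.ne).2,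
    adjMatrix_apply, if_pos hij] at h
  linarith

/-- The smallest eigenvalue is at most every eigenvalue. -/
theorem minEigval_le_of_eigenvector {V : Type*} [Fintype V] (G : SimpleGraph V) {x : V → ℝ}
    (hx : x ≠ 0) {c : ℝ} (h : open Classical in G.adjMatrix ℝ *ᵥ x = c • x) :
    G.minEigval ≤ c := by
  classical
  have : Nonempty V := by
    by_contra h0
    rw [not_nonempty_iff] at h0
    exact hx (Subsingleton.elim _ _)
  have h1 := G.minEigval_mul_le.1 x
  rw [h, dotProduct_smul, smul_eq_mul] at h1
  have h2 : 0 < x ⬝ᵥ x := by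
    refine lt_of_le_of_ne (by simpa using dotProduct_star_self_nonneg x) fun h0 => hx ?_
    exact dotProduct_self_eq_zero.mp h0.symm
  exact le_of_mul_le_mul_right h1 h2

/-- A λ_min-eigenvector in one factor, tensored with all-ones vectors in the other k, is an
eigenvector of the power. -/
theorem minEigval_strongPower_le {V : Type*} [Fintype V] [Nonempty V] (G : SimpleGraph V)
    {d : ℝ} (hd : G.closedAdjMatrix *ᵥ 1 = (1 + d) • 1) (k : ℕ) :
    (G.strongPower (k + 1)).minEigval ≤ (1 + d) ^ k * (1 + G.minEigval) - 1 := by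
  classical
  obtain ⟨x, hx0, hx⟩ := G.minEigval_mul_le.2
  rw [adjMatrix_mulVec_eq_smul_iff] at hx
  have h := G.closedAdjMatrix_strongPower_mulVec (k := k + 1) (f := Fin.cons x fun _ => 1)
    (α := Fin.cons (1 + G.minEigval) fun _ => 1 + d)
    (Fin.cases (by simpa using hx) fun i => by simpa using hd)
  refine (G.strongPower (k + 1)).minEigval_le_of_eigenvector ?_
    (((G.strongPower (k + 1)).adjMatrix_mulVec_eq_smul_iff _ _).2 (h.trans ?_))
  · intro h0
    refine hx0 (funext fun v => ?_)
    simpa [Fin.prod_univ_succ] using congrFun h0 fun _ => v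
  · congr 1
    simp only [Fin.prod_univ_succ, Fin.cons_zero, Fin.cons_succ, Finset.prod_const,
      Finset.card_univ, Fintype.card_fin]
    ring

/-! ### Scaled representations and the theta function -/

/-- Vectors `w x` with `c ⬝ᵥ w x = 1` for a unit vector `c`, of squared norm at most `T`, with
orthogonal vectors for distinct non-adjacent vertices: an orthonormal representation, rescaled to
have inner product `1` with `c`. -/
structure IsScaledRep {V ι : Type*} [Fintype ι] (G : SimpleGraph V) (w : V → ι → ℝ) (c : ι → ℝ)
    (T : ℝ) : Prop where
  dotProduct_self : c ⬝ᵥ c = 1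
  dotProduct_eq_one : ∀ x, c ⬝ᵥ w x = 1
  dotProduct_le : ∀ x, w x ⬝ᵥ w x ≤ T
  dotProduct_eq_zero : ∀ x y, x ≠ y → ¬ G.Adj x y → w x ⬝ᵥ w y = 0

/-- The values of which `lovaszTheta` is the infimum. -/
def thetaValues {V : Type*} (G : SimpleGraph V) : Set ℝ :=
  {t : ℝ | ∃ (m : ℕ) (u : V → EuclideanSpace ℝ (Fin m)) (c : EuclideanSpace ℝ (Fin m)),
    G.IsOrthonormalRep u ∧ ‖c‖ = 1 ∧ (∀ i, inner ℝ c (u i) ≠ 0) ∧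
      t = ⨆ i, 1 / (inner ℝ c (u i)) ^ 2}

theorem inner_eq_dotProduct {ι : Type*} [Fintype ι] (x y : EuclideanSpace ℝ ι) :
    inner ℝ x y = (x : ι → ℝ) ⬝ᵥ y := by
  rw [EuclideanSpace.inner_eq_star_dotProduct, star_trivial, dotProduct_comm]

theorem exists_isScaledRep {V : Type*} [Finite V] (G : SimpleGraph V) {t : ℝ}
    (ht : t ∈ G.thetaValues) :
    ∃ (m : ℕ) (w : V → Fin m → ℝ) (c : Fin m → ℝ), G.IsScaledRep w c t := by
  obtain ⟨m, u, c, ⟨hu1, hu0⟩, hc, hcu, rfl⟩ := ht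
  refine ⟨m, fun x => (inner ℝ c (u x))⁻¹ • (u x : Fin m → ℝ), c, ?_, fun x => ?_, fun x => ?_,
    fun x y hxy hadj => ?_⟩
  · rw [← inner_eq_dotProduct, real_inner_self_eq_norm_sq, hc, one_pow]
  · rw [dotProduct_smul, ← inner_eq_dotProduct, smul_eq_mul, inv_mul_cancel₀ (hcu x)]
  · have h : (u x : Fin m → ℝ) ⬝ᵥ u x = 1 := by
      rw [← inner_eq_dotProduct, real_inner_self_eq_norm_sq, hu1, one_pow]
    rw [dotProduct_smul, smul_dotProduct, h, smul_eq_mul, smul_eq_mul, mul_one]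
    refine le_trans (le_of_eq ?_)
      (le_ciSup (f := fun i => 1 / (inner ℝ c (u i)) ^ 2) (Set.finite_range _).bddAbove x)
    rw [one_div, sq, mul_inv]
  · rw [dotProduct_smul, smul_dotProduct, ← inner_eq_dotProduct, hu0 x y hxy hadj, smul_zero,
      smul_zero]

theorem IsScaledRep.one_le_dotProduct {V ι : Type*} [Fintype ι] {G : SimpleGraph V}
    {w : V → ι → ℝ} {c : ι → ℝ} {T : ℝ} (h : G.IsScaledRep w c T) (x : V) :
    1 ≤ w x ⬝ᵥ w x := by
  have h0 : 0 ≤ (w x - c) ⬝ᵥ (w x - c) := by simpa using dotProduct_star_self_nonneg (w x - c)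
  simp only [dotProduct_sub, sub_dotProduct, dotProduct_comm (w x) c, h.dotProduct_self,
    h.dotProduct_eq_one] at h0
  linarith

/-- Normalising each `w x` undoes the scaling. The index type is arbitrary so that tensor powers,
indexed by tuples, are covered. -/
theorem IsScaledRep.exists_thetaValues_le {V ι : Type*} [Nonempty V] [Fintype ι]
    {G : SimpleGraph V} {w : V → ι → ℝ} {c : ι → ℝ} {T : ℝ} (h : G.IsScaledRep w c T) :
    ∃ t ∈ G.thetaValues, t ≤ T := by
  let e := LinearIsometryEquiv.piLpCongrLeft 2 ℝ ℝ (Fintype.equivFin ι)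
  have hpos : ∀ x, 0 < √(w x ⬝ᵥ w x) := fun x =>
    Real.sqrt_pos.2 (one_pos.trans_le (h.one_le_dotProduct x))
  have hsq : ∀ x, √(w x ⬝ᵥ w x) ^ 2 = w x ⬝ᵥ w x := fun x =>
    Real.sq_sqrt (zero_le_one.trans (h.one_le_dotProduct x))
  have hnorm : ∀ v : ι → ℝ, ‖WithLp.toLp 2 v‖ = √(v ⬝ᵥ v) := fun v => by
    rw [← Real.sqrt_sq (norm_nonneg (WithLp.toLp 2 v)), ← real_inner_self_eq_norm_sq,
      inner_eq_dotProduct]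
  have hcu : ∀ x, inner ℝ (e (WithLp.toLp 2 c)) (e ((√(w x ⬝ᵥ w x))⁻¹ • WithLp.toLp 2 (w x)))
      = (√(w x ⬝ᵥ w x))⁻¹ := fun x => by
    rw [e.inner_map_map, inner_smul_right, inner_eq_dotProduct]
    simp [h.dotProduct_eq_one]
  refine ⟨_, ⟨_, fun x => e ((√(w x ⬝ᵥ w x))⁻¹ • WithLp.toLp 2 (w x)), e (WithLp.toLp 2 c),
    ⟨fun x => ?_, fun x y hxy hadj => ?_⟩, ?_, fun x => ?_, rfl⟩, ciSup_le fun x => ?_⟩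
  · rw [e.norm_map, norm_smul, hnorm, Real.norm_of_nonneg (inv_nonneg.2 (hpos x).le),
      inv_mul_cancel₀ (hpos x).ne']
  · rw [e.inner_map_map, inner_smul_left, inner_smul_right, inner_eq_dotProduct]
    simp [h.dotProduct_eq_zero x y hxy hadj]
  · rw [e.norm_map, hnorm, h.dotProduct_self, Real.sqrt_one]
  · rw [hcu]
    exact inv_ne_zero (hpos x).ne'
  · rw [hcu, one_div, inv_pow, inv_inv, hsq]
    exact h.dotProduct_le x

theorem one_le_of_mem_thetaValues {V : Type*} [Finite V] [Nonempty V] {G : SimpleGraph V} {t : ℝ}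
    (ht : t ∈ G.thetaValues) : 1 ≤ t := by
  obtain ⟨m, w, c, h⟩ := G.exists_isScaledRep ht
  obtain ⟨x⟩ := ‹Nonempty V›
  exact (h.one_le_dotProduct x).trans (h.dotProduct_le x)

theorem thetaValues_nonempty {V : Type*} [Fintype V] [Nonempty V] (G : SimpleGraph V) :
    G.thetaValues.Nonempty := by
  classical
  have hN : (0 : ℝ) < Fintype.card V := by simp [Fintype.card_pos]
  have hs := Real.sq_sqrt hN.le
  have hs0 := (Real.sqrt_pos.2 hN).ne'
  have h : G.IsScaledRep (fun x => Pi.single x (√(Fintype.card V)))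
      (fun _ => (√(Fintype.card V))⁻¹) (Fintype.card V) := by
    refine ⟨?_, fun x => ?_, fun x => ?_, fun x y hxy _ => ?_⟩
    · simp only [dotProduct, Finset.sum_const, Finset.card_univ, nsmul_eq_mul, ← sq, inv_pow, hs]
      exact mul_inv_cancel₀ hN.ne'
    · simp [hs0]
    · simp
    · simp [hxy]
  obtain ⟨t, ht, _⟩ := h.exists_thetaValues_le
  exact ⟨t, ht⟩

theorem one_le_lovaszTheta {V : Type*} [Fintype V] [Nonempty V] (G : SimpleGraph V) :
    1 ≤ G.lovaszTheta :=
  le_csInf G.thetaValues_nonempty fun _ => one_le_of_mem_thetaValues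

theorem IsScaledRep.lovaszTheta_le {V ι : Type*} [Finite V] [Nonempty V] [Fintype ι]
    {G : SimpleGraph V} {w : V → ι → ℝ} {c : ι → ℝ} {T : ℝ} (h : G.IsScaledRep w c T) :
    G.lovaszTheta ≤ T := by
  obtain ⟨t, ht, htT⟩ := h.exists_thetaValues_le
  exact (csInf_le ⟨1, fun _ => one_le_of_mem_thetaValues⟩ ht).trans htT

/-- Tensor powers of representations. -/
theorem IsScaledRep.strongPower {V ι : Type*} [Fintype ι] {G : SimpleGraph V}
    {w : V → ι → ℝ} {c : ι → ℝ} {T : ℝ} (h : G.IsScaledRep w c T) (k : ℕ) :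
    (G.strongPower k).IsScaledRep (fun x (a : Fin k → ι) => ∏ i, w (x i) (a i))
      (fun a => ∏ i, c (a i)) (T ^ k) := by
  classical
  have key : ∀ f g : Fin k → ι → ℝ, (fun a : Fin k → ι => ∏ i, f i (a i)) ⬝ᵥ
      (fun a => ∏ i, g i (a i)) = ∏ i, f i ⬝ᵥ g i := fun f g => by
    simp only [dotProduct, ← Finset.prod_mul_distrib]
    exact (Fintype.prod_sum fun i j => f i j * g i j).symm
  refine ⟨?_, fun x => ?_, fun x => ?_, fun x y hxy hadj => ?_⟩
  · rw [key, Finset.prod_congr rfl fun _ _ => h.dotProduct_self, Finset.prod_const_one]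
  · rw [key, Finset.prod_congr rfl fun i _ => h.dotProduct_eq_one (x i), Finset.prod_const_one]
  · rw [key]
    refine (Finset.prod_le_prod (fun i _ => zero_le_one.trans (h.one_le_dotProduct (x i)))
      fun i _ => h.dotProduct_le (x i)).trans ?_
    simp
  · rw [key]
    have : ¬ ∀ i, x i = y i ∨ G.Adj (x i) (y i) := fun h' => hadj ⟨hxy, h'⟩
    push Not at this
    obtain ⟨i, hi, hi'⟩ := this
    exact Finset.prod_eq_zero (Finset.mem_univ i) (h.dotProduct_eq_zero _ _ hi hi')

/-! ### The second eigenvalue bound -/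

open Classical in
/-- The bound of the second eigenvalue by a representation. -/
theorem IsScaledRep.card_sub_le {V ι : Type*} [Fintype V] [Fintype ι] {G : SimpleGraph V}
    {w : V → ι → ℝ} {c : ι → ℝ} {T : ℝ} (h : G.IsScaledRep w c T) (h1 : 1 < Fintype.card V)
    {D : ℝ} (hD : G.adjMatrix ℝ *ᵥ 1 = D • 1) :
    Fintype.card V - (1 + D) ≤ (1 + G.eigval 2) * (T - 1) := by
  obtain ⟨hm1, hquad⟩ := G.eigval_two_bounds h1 hD
  set l := G.eigval 2
  have hN : (0 : ℝ) < Fintype.card V := by exact_mod_cast (by omega : 0 < Fintype.card V)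
  set C := G.closedAdjMatrix
  have hCquad : ∀ x : V → ℝ, 0 ≤ ∑ i, ∑ j, (1 - C i j) * (x i * x j) + (1 + l) * (x ⬝ᵥ x) := by
    intro x
    have e1 : x ⬝ᵥ C *ᵥ x = x ⬝ᵥ G.adjMatrix ℝ *ᵥ x + x ⬝ᵥ x := by
      simp only [C, closedAdjMatrix, Matrix.add_mulVec, Matrix.one_mulVec, dotProduct_add]
    have e2 : ∑ i, ∑ j, (1 - C i j) * (x i * x j) = (∑ i, x i) ^ 2 - x ⬝ᵥ C *ᵥ x := by
      rw [sq, Finset.sum_mul_sum]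
      simp only [dotProduct, Matrix.mulVec, Finset.mul_sum, ← Finset.sum_sub_distrib]
      exact Finset.sum_congr rfl fun i _ => Finset.sum_congr rfl fun j _ => by ring
    have := hquad x
    rw [e2, e1]
    linarith
  -- Summing the quadratic form over the coordinates of w_i - c pairs it with their Gram matrix.
  have hsum : 0 ≤ ∑ a, (∑ i, ∑ j, (1 - C i j) * ((w i a - c a) * (w j a - c a)) +
      (1 + l) * ((fun i => w i a - c a) ⬝ᵥ fun i => w i a - c a)) :=
    Finset.sum_nonneg fun a _ => hCquad fun i => w i a - c a
  have hgram : ∀ i j, ∑ a, (w i a - c a) * (w j a - c a) = w i ⬝ᵥ w j - 1 := by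
    intro i j
    have e : (w i - c) ⬝ᵥ (w j - c) = w i ⬝ᵥ w j - 1 := by
      simp only [dotProduct_sub, sub_dotProduct, dotProduct_comm (w i) c, h.dotProduct_self,
        h.dotProduct_eq_one]
      ring
    exact e
  have e1 : ∑ a, ∑ i, ∑ j, (1 - C i j) * ((w i a - c a) * (w j a - c a)) =
      -(Fintype.card V * (Fintype.card V - (1 + D))) := by
    rw [Finset.sum_comm]
    have hrow : ∀ i, ∑ j, C i j = 1 + D := fun i => by
      rw [adjMatrix_mulVec_eq_smul_iff] at hD
      simpa [Matrix.mulVec, dotProduct] using congrFun hD i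
    have : ∀ i, ∑ a, ∑ j, (1 - C i j) * ((w i a - c a) * (w j a - c a)) =
        -(Fintype.card V - (1 + D)) := by
      intro i
      rw [Finset.sum_comm]
      simp only [← Finset.mul_sum, hgram]
      -- Where C is 1 both sides vanish; elsewhere orthogonality makes both equal to -1.
      have : ∀ j, (1 - C i j) * (w i ⬝ᵥ w j - 1) = C i j - 1 := by
        intro j
        simp only [C, closedAdjMatrix_apply]
        split_ifs with hij
        · simp
        · push Not at hij
          rw [h.dotProduct_eq_zero i j hij.1 hij.2]
          ring
      simp only [this, Finset.sum_sub_distrib, hrow]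
      simp
    simp only [this, Finset.sum_const, Finset.card_univ, nsmul_eq_mul, mul_neg]
  have e2 : ∑ a, (1 + l) * ((fun i => w i a - c a) ⬝ᵥ fun i => w i a - c a) ≤
      (1 + l) * (Fintype.card V * (T - 1)) := by
    rw [← Finset.mul_sum]
    refine mul_le_mul_of_nonneg_left ?_ (by linarith)
    simp only [dotProduct]
    rw [Finset.sum_comm]
    simp only [hgram]
    calc ∑ i, (w i ⬝ᵥ w i - 1) ≤ ∑ i : V, (T - 1) :=
          Finset.sum_le_sum fun i _ => by linarith [h.dotProduct_le i]
      _ = _ := by rw [Finset.sum_const, Finset.card_univ, nsmul_eq_mul]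
  rw [Finset.sum_add_distrib, e1] at hsum
  refine le_of_mul_le_mul_left ?_ hN
  linarith

theorem closedAdjMatrix_mulVec_one_of_regular {V : Type*} [Fintype V] {G : SimpleGraph V}
    [DecidableRel G.Adj] {d : ℕ} (hd : G.IsRegularOfDegree d) :
    G.closedAdjMatrix *ᵥ 1 = (1 + (d : ℝ)) • 1 := by
  classical
  rw [← adjMatrix_mulVec_eq_smul_iff]
  ext v
  have h := adjMatrix_mulVec_const_apply_of_regular (α := ℝ) (a := 1) hd (v := v)
  rw [mul_one] at h
  rw [Pi.smul_apply, Pi.one_apply, smul_eq_mul, mul_one, ← h]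
  congr!

/-! ### Hoffman's bound and the comparison of powers -/

open scoped MatrixOrder Matrix.Norms.L2Operator in
/-- Hoffman's bound on the Lovász theta function of a regular graph. -/
theorem lovaszTheta_mul_le {V : Type*} [Fintype V] [Nonempty V] (G : SimpleGraph V) {d : ℝ}
    (hd : open Classical in G.adjMatrix ℝ *ᵥ 1 = d • 1) (hd0 : 0 < d) (hm : G.minEigval < 0) :
    G.lovaszTheta ≤ Fintype.card V * -G.minEigval / (d + -G.minEigval) := by
  classical
  set μ := -G.minEigval with hμ
  have hμ0 : 0 < μ := by linarith
  set n : ℝ := (Fintype.card V : ℝ) with hn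
  have hn0 : 0 < n := by simp [hn, Fintype.card_pos]
  set t := n * μ / (d + μ) with ht
  have hA := G.adjMatrix_real_isHermitian
  -- The value of t makes M annihilate the all-ones vector; on zero-sum vectors M is semidefinite
  -- since A + μI is. J + M has diagonal t and vanishes at distinct non-adjacent pairs.
  set M : Matrix V V ℝ := (t / μ) • (G.adjMatrix ℝ + μ • 1) - Matrix.of fun _ _ => 1 with hM
  have hpsd : M.PosSemidef := by
    refine .of_dotProduct_mulVec_nonneg ?_ fun x => ?_
    · ext i j
      simp [hM, adjMatrix_apply, G.adj_comm, Matrix.one_apply, eq_comm]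
    · obtain ⟨a, y, hy, hs, hxx, hxA⟩ := exists_constant_add_of_mulVec_one hA hd x
      have hJ : x ⬝ᵥ (Matrix.of fun _ _ => 1 : Matrix V V ℝ) *ᵥ x = (∑ i, x i) ^ 2 := by
        simp [Matrix.mulVec, dotProduct, ← Finset.sum_mul, sq]
      rw [star_trivial, hM, Matrix.sub_mulVec, Matrix.smul_mulVec, Matrix.add_mulVec,
        Matrix.smul_mulVec, Matrix.one_mulVec, dotProduct_sub, dotProduct_smul, dotProduct_add,
        dotProduct_smul, hJ, hs, hxx, hxA, smul_eq_mul, smul_eq_mul, ← hn]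
      have h1 := G.minEigval_mul_le.1 y
      have h2 : 0 ≤ t / μ * (y ⬝ᵥ G.adjMatrix ℝ *ᵥ y + μ * (y ⬝ᵥ y)) :=
        mul_nonneg (by positivity) (by rw [hμ]; linarith)
      have h3 : t / μ * (d + μ) = n := by
        rw [ht]; field_simp
      linear_combination h2 - a ^ 2 * n * h3
  obtain ⟨B, hB⟩ := CStarAlgebra.nonneg_iff_eq_star_mul_self.mp hpsd.nonneg
  have hgram : ∀ x y, ∑ i, B i x * B i y = M x y := fun x y => by
    rw [hB]
    simp [Matrix.mul_apply, Matrix.star_apply]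
  -- The extra coordinate `none`, constantly 1, turns the Gram matrix M into J + M and supplies c.
  have hdot : ∀ x y, (fun o : Option V => o.elim 1 fun i => B i x) ⬝ᵥ
      (fun o : Option V => o.elim 1 fun i => B i y) = 1 + M x y := fun x y => by
    simp [dotProduct, Fintype.sum_option, hgram]
  have hrep : G.IsScaledRep (fun x (o : Option V) => o.elim 1 fun i => B i x)
      (fun o => o.elim 1 fun _ => 0) t := by
    refine ⟨?_, fun x => ?_, fun x => ?_, fun x y hxy hadj => ?_⟩
    · simp [dotProduct, Fintype.sum_option]
    · simp [dotProduct, Fintype.sum_option]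
    · rw [hdot]
      apply le_of_eq
      simp [hM]
      field_simp
    · rw [hdot]
      simp [hM, hxy, hadj]
  exact hrep.lovaszTheta_le

/-- With s = 1 + d/μ, both differences of powers are geometric sums, with factors a - 1 = d and s -
1 = d/μ, so it suffices to compare terms. -/
theorem pow_sub_one_le_of_hoffman {a d μ : ℝ} (hd : 0 < d) (hμ : 1 ≤ μ) (ha : a = 1 + d) (k : ℕ) :
    a ^ (k + 1) - 1 ≤ (a ^ k * (μ - 1) + 1) * ((1 + d / μ) ^ (k + 1) - 1) := by
  have hμ0 : 0 < μ := by linarith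
  set s := 1 + d / μ with hs
  have hs0 : 0 < s := by positivity
  have hterm : ∀ i ∈ Finset.range (k + 1), μ * a ^ i ≤ (a ^ k * (μ - 1) + 1) * s ^ i := by
    intro i hi
    have hik : a ^ i ≤ a ^ k :=
      pow_le_pow_right₀ (by linarith) (Nat.lt_succ_iff.1 (Finset.mem_range.1 hi))
    -- Convexity of the i-th power between a and 1, with weights (μ - 1)/μ and 1/μ, lifts `hle` from
    -- a/s to (a/s)^i.
    obtain ⟨-, hcvx⟩ := convexOn_pow (𝕜 := ℝ) i
    have hconv := hcvx (Set.mem_Ici.2 (by linarith : 0 ≤ a))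
      (Set.mem_Ici.2 zero_le_one) (show 0 ≤ (μ - 1) / μ by apply div_nonneg <;> linarith)
      (show 0 ≤ 1 / μ by positivity) (by field_simp; ring)
    simp only [smul_eq_mul, one_pow] at hconv
    have hle : a / s ≤ (μ - 1) / μ * a + 1 / μ * 1 := by
      rw [div_le_iff₀ hs0, hs, ha, ← sub_nonneg]
      have : ((μ - 1) / μ * (1 + d) + 1 / μ * 1) * (1 + d / μ) - (1 + d) =
          d ^ 2 * (μ - 1) / μ ^ 2 := by
        field_simp
        ring
      rw [this]
      apply div_nonneg (mul_nonneg (sq_nonneg _) (by linarith)) (sq_nonneg _)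
    have h1 := (pow_le_pow_left₀ (by rw [ha]; positivity) hle i).trans hconv
    rw [div_pow, div_le_iff₀ (by positivity)] at h1
    have h2 : μ * a ^ i ≤ (a ^ i * (μ - 1) + 1) * s ^ i := by
      calc μ * a ^ i ≤ μ * (((μ - 1) / μ * a ^ i + 1 / μ * 1) * s ^ i) :=
            mul_le_mul_of_nonneg_left h1 hμ0.le
        _ = _ := by field_simp
    refine h2.trans (mul_le_mul_of_nonneg_right ?_ (by positivity))
    have := mul_le_mul_of_nonneg_right hik (sub_nonneg.2 hμ)
    linarith
  have hsum := Finset.sum_le_sum hterm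
  rw [← Finset.mul_sum, ← Finset.mul_sum] at hsum
  have g1 := geom_sum_mul a (k + 1)
  have g2 := geom_sum_mul s (k + 1)
  rw [show a - 1 = d by rw [ha]; ring] at g1
  rw [show s - 1 = d / μ by rw [hs]; ring] at g2
  rw [← g1, ← g2]
  calc _ = (μ * ∑ i ∈ Finset.range (k + 1), a ^ i) * (d / μ) := by field_simp
    _ ≤ _ := mul_le_mul_of_nonneg_right hsum (by positivity)
    _ = _ := by ring

end SimpleGraph

end

/-! ### The main theorem -/

open SimpleGraph

theorem mainTheorem12 {V : Type*} [Fintype V] (G : SimpleGraph V) [DecidableRel G.Adj]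
    (n d : ℕ) (hn : Fintype.card V = n) (hd : G.IsRegularOfDegree d) (k : ℕ) (hk : 1 ≤ k) :
    (G ≠ ⊤ →
      0 < G.lovaszTheta ^ k - 1 ∧
      (G.strongPower k).eigval 2 ≥
        ((n : ℝ) ^ k - (1 + (d : ℝ)) ^ k) / (G.lovaszTheta ^ k - 1) - 1) ∧
    (G ≠ ⊥ →
      0 < ((n : ℝ) / G.lovaszTheta) ^ k - 1 ∧
      (G.strongPower k).minEigval ≤
        -(((1 + (d : ℝ)) ^ k - 1) / (((n : ℝ) / G.lovaszTheta) ^ k - 1))) := by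
  have hC := closedAdjMatrix_mulVec_one_of_regular hd
  have hA := (adjMatrix_mulVec_eq_smul_iff G 1 d).2 hC
  have hk0 : k ≠ 0 := by omega
  constructor
  · intro hG
    have hH := (adjMatrix_mulVec_eq_smul_iff (G.strongPower k) 1 ((1 + (d : ℝ)) ^ k - 1)).2 <| by
      have := G.closedAdjMatrix_strongPower_mulVec (k := k) (f := fun _ => 1) fun _ => hC
      simp only [Pi.one_apply, Finset.prod_const_one, Finset.prod_const, Finset.card_univ,
        Fintype.card_fin] at this
      rw [add_sub_cancel]
      exact this
    obtain ⟨i, j, hij, hadj⟩ := SimpleGraph.ne_top_iff_exists_not_adj.1 hG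
    have hdn : d + 1 < n := by
      classical
      have h1 : G.neighborFinset i ⊆ (Finset.univ.erase i).erase j := fun x hx => by
        rw [mem_neighborFinset] at hx
        simp only [Finset.mem_erase, Finset.mem_univ, and_true]
        exact ⟨fun h => hadj (h ▸ hx), hx.ne'⟩
      have h2 := Finset.card_le_card h1
      rw [card_neighborFinset_eq_degree, hd i, Finset.card_erase_of_mem (by simp [hij.symm]),
        Finset.card_erase_of_mem (by simp), Finset.card_univ, hn] at h2
      have : 1 < n := hn ▸ Fintype.one_lt_card_iff.2 ⟨i, j, hij⟩
      have : d ≠ n - 2 + 1 := by omega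
      by_contra! h3
      have : n = 2 := by omega
      omega
    have : Nonempty V := ⟨i⟩
    have hcard : Fintype.card (Fin k → V) = n ^ k := by simp [hn]
    have h1 : 1 < Fintype.card (Fin k → V) := by
      rw [hcard]
      exact Nat.one_lt_pow hk0 (by omega)
    have hval : ∀ t ∈ G.thetaValues,
        (n : ℝ) ^ k - (1 + d) ^ k ≤ (1 + (G.strongPower k).eigval 2) * (t ^ k - 1) := by
      intro t ht
      obtain ⟨m, w, c, h⟩ := G.exists_isScaledRep ht
      have := (h.strongPower k).card_sub_le h1 hH
      rwa [hcard, add_sub_cancel, Nat.cast_pow] at this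
    -- A closed condition on t passes to the infimum, so attainment of the minimum is not needed.
    have hclosed : IsClosed {t : ℝ | (n : ℝ) ^ k - (1 + d) ^ k ≤
        (1 + (G.strongPower k).eigval 2) * (t ^ k - 1)} :=
      isClosed_le continuous_const (by fun_prop)
    have hθ : (n : ℝ) ^ k - (1 + d) ^ k ≤
        (1 + (G.strongPower k).eigval 2) * (G.lovaszTheta ^ k - 1) :=
      closure_minimal hval hclosed (csInf_mem_closure G.thetaValues_nonempty
        ⟨1, fun _ => one_le_of_mem_thetaValues⟩)
    have hpos : 0 < (n : ℝ) ^ k - (1 + d) ^ k := by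
      refine sub_pos.2 (pow_lt_pow_left₀ ?_ (by positivity) hk0)
      rw [add_comm]
      exact_mod_cast hdn
    have hθ1 : 0 ≤ G.lovaszTheta ^ k - 1 := sub_nonneg.2 (one_le_pow₀ G.one_le_lovaszTheta)
    -- If θ^k were 1, the bound `hθ` would contradict n > 1 + d.
    have hθ2 : 0 < G.lovaszTheta ^ k - 1 := by
      refine lt_of_le_of_ne hθ1 fun h => ?_
      rw [← h, mul_zero] at hθ
      linarith
    refine ⟨hθ2, ?_⟩
    rw [ge_iff_le, sub_le_iff_le_add, div_le_iff₀ hθ2]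
    linarith
  · intro hG
    obtain ⟨i, j, hadj⟩ := SimpleGraph.ne_bot_iff_exists_adj.1 hG
    have : Nonempty V := ⟨i⟩
    have hd0 : (0 : ℝ) < d := by
      rw [Nat.cast_pos, ← hd i]
      exact (G.degree_pos_iff_exists_adj i).2 ⟨j, hadj⟩
    have hm := G.minEigval_le_neg_one hG
    have hθ := G.lovaszTheta_mul_le hA hd0 (by linarith)
    obtain ⟨k, rfl⟩ : ∃ k', k = k' + 1 := ⟨k - 1, by omega⟩
    have hmin := G.minEigval_strongPower_le hC k
    set μ := -G.minEigval with hμ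
    have hμ1 : 1 ≤ μ := by linarith
    have hθ0 : 0 < G.lovaszTheta := one_pos.trans_le G.one_le_lovaszTheta
    have hs : 1 + d / μ ≤ n / G.lovaszTheta := by
      rw [le_div_iff₀ hθ0]
      rw [hn, le_div_iff₀ (by linarith)] at hθ
      have hμ0 : 0 < μ := by linarith
      calc (1 + d / μ) * G.lovaszTheta = G.lovaszTheta * (d + μ) / μ := by field_simp; ring
        _ ≤ n * μ / μ := by gcongr
        _ = n := by field_simp
    have hμd : 0 < d / μ := div_pos hd0 (by linarith)
    have hpow : (1 + d / μ) ^ (k + 1) ≤ (n / G.lovaszTheta) ^ (k + 1) :=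
      pow_le_pow_left₀ (by linarith) hs _
    have hpos : 0 < (n / G.lovaszTheta) ^ (k + 1) - 1 :=
      sub_pos.2 (one_lt_pow₀ (by linarith) hk0)
    refine ⟨hpos, ?_⟩
    have hkey := pow_sub_one_le_of_hoffman hd0 hμ1 rfl k
    have hb : 0 ≤ (1 + (d : ℝ)) ^ k * (μ - 1) + 1 :=
      add_nonneg (mul_nonneg (by positivity) (by linarith)) zero_le_one
    have h3 : ((1 + (d : ℝ)) ^ (k + 1) - 1) / ((n / G.lovaszTheta) ^ (k + 1) - 1) ≤
        (1 + (d : ℝ)) ^ k * (μ - 1) + 1 := by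
      rw [div_le_iff₀ hpos]
      exact hkey.trans (mul_le_mul_of_nonneg_left (by linarith) hb)
    have h4 : (1 + (d : ℝ)) ^ k * (1 + G.minEigval) - 1 =
        -((1 + (d : ℝ)) ^ k * (μ - 1) + 1) := by rw [hμ]; ring
    linarith
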